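/- Let $E$ be a reflexive real Banach space, let $X \subseteq E$ be nonempty and convex, and let $f : X \times X \to \mathbb{R}$ satisfy: (i) for every $y \in X$, the function $x \mapsto f(x,y)$ is quasi-concave on $X$, i.e. for every $l \in \mathbb{R}$ the set $\{x \in X : f(x,y) \ge l\}$ is convex; (ii) for every $x \in X$, the function $y \mapsto f(x,y)$ is weakly lower semicontinuous on $X$, in the sense that for every $l \in \mathbb{R}$ the set $\{y \in X : f(x,y) \le l\}$ is closed in the weak topology of $E$ (closed in $E$, not merely relatively closed in $X$); (iii) $m := \sup_{x \in X} f(x,x) < +\infty$; (iv) there is a point $x_0 \in X$ such that the set $\{y \in X : f(x_0,y) \le m\}$ is bounded. Then the function $y \mapsto \sup_{x \in X} f(x,y) \in (-\infty, +\infty]$ attains its minimum on $X$, and $$\min_{y \in X} \, \sup_{x \in X} f(x,y) \;\le\; \sup_{x \in X} f(x,x).$$ -/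

import Mathlib

/-- A real normed space is reflexive if the canonical embedding into its bidual is onto. -/
def IsReflexiveSpace (E : Type*) [NormedAddCommGroup E] [NormedSpace ℝ E] : Prop :=
  Function.Surjective (NormedSpace.inclusionInDoubleDual ℝ E)

/-- A subset of a real normed space is weakly closed if it is closed for the weak topology
of the whole space. -/
def IsWeaklyClosed {E : Type*} [NormedAddCommGroup E] [NormedSpace ℝ E] (s : Set E) : Prop :=
  IsClosed (toWeakSpace ℝ E '' s)

/-- `g` is weakly lower semicontinuous on `X`: every sublevel set `{y ∈ X | g y ≤ l}` is weakly
closed, as a subset of `E`. The values of `g` outside `X` play no role. -/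
def WeaklyLowerSemicontinuousOn {E : Type*} [NormedAddCommGroup E] [NormedSpace ℝ E]
    (X : Set E) (g : E → ℝ) : Prop :=
  ∀ l : ℝ, IsWeaklyClosed {y ∈ X | g y ≤ l}

/-! The sets `{y ∈ X | f x y ≤ m}` are weakly closed, and the one for `x₀` is weakly compact by
reflexivity, so all of them share a point as soon as any finitely many do. For finitely many `x`,
pull their sets back to the standard simplex along convex combinations. A point `y` of the simplex
lying in none of the sets of its supporting vertices would satisfy `f y y > m` by quasi-concavity;
hence the KKM lemma `exists_mem_stdSimplex_iInter` applies. The common points form a weakly compact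
set on which the supremum, weakly lower semicontinuous, attains its minimum; elsewhere on `X` it
exceeds `m`.

KKM is derived from Scarf's lemma `exists_isDominated_rainbow`, a parity count of doors and rooms.
On a fine grid of the simplex it puts every colour, or else the opposite face, near a single point;
compactness then gives the limit. -/

theorem Finset.exists_eq_erase_of_subset {V : Type*} [DecidableEq V] {s t : Finset V} (hst : s ⊆ t)
    (hcard : s.card + 1 = t.card) : ∃ x ∈ t, s = t.erase x := by
  obtain ⟨x, hx, rfl⟩ := Finset.exists_eq_insert_iff.2 ⟨hst, hcard⟩
  exact ⟨x, by simp, by simp [hx]⟩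

/-! ### Scarf's lemma by a parity argument -/

section Scarf

variable {I V L : Type*} [LinearOrder L]

/-- A finset `s` is dominated, with respect to a family of rankings `r i`, if every point lies
weakly below all of `s` in one of the rankings. -/
def IsDominated (r : I → V → L) (s : Finset V) : Prop :=
  ∀ y, ∃ i, ∀ x ∈ s, r i y ≤ r i x

theorem IsDominated.mono {r : I → V → L} {s t : Finset V} (h : IsDominated r t) (hst : s ⊆ t) :
    IsDominated r s := fun y => (h y).imp fun _ hi x hx => hi x (hst hx)

variable [Fintype I] [Fintype V]

open Classical in
/-- The rooms: dominated sets with as many elements as there are rankings. -/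
noncomputable def scarfRooms (r : I → V → L) : Finset (Finset V) :=
  {s | s.card = Fintype.card I ∧ IsDominated r s}

theorem mem_scarfRooms {r : I → V → L} {s : Finset V} :
    s ∈ scarfRooms r ↔ s.card = Fintype.card I ∧ IsDominated r s := by
  simp [scarfRooms]

variable [DecidableEq I]

open Classical in
/-- The doors with missing colour `i₀`: dominated sets on which every other colour appears
exactly once. -/
noncomputable def scarfDoors (r : I → V → L) (c : V → I) (i₀ : I) : Finset (Finset V) :=
  {t | t.card + 1 = Fintype.card I ∧ IsDominated r t ∧ t.image c = Finset.univ.erase i₀}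

theorem mem_scarfDoors {r : I → V → L} {c : V → I} {i₀ : I} {t : Finset V} :
    t ∈ scarfDoors r c i₀ ↔
      t.card + 1 = Fintype.card I ∧ IsDominated r t ∧ t.image c = Finset.univ.erase i₀ := by
  simp [scarfDoors]

variable [DecidableEq V]

theorem erase_mem_scarfDoors {r : I → V → L} {c : V → I} {i₀ : I} {s : Finset V}
    (hs : s ∈ scarfRooms r) {x : V} (hx : x ∈ s) :
    s.erase x ∈ scarfDoors r c i₀ ↔ (s.erase x).image c = Finset.univ.erase i₀ := by
  rw [mem_scarfRooms] at hs
  rw [mem_scarfDoors]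
  refine ⟨fun h => h.2.2, fun h => ⟨?_, hs.2.mono (Finset.erase_subset _ _), h⟩⟩
  rw [Finset.card_erase_add_one hx, hs.1]

theorem exists_eq_erase_of_mem_scarfDoors {r : I → V → L} {c : V → I} {i₀ : I} {s t : Finset V}
    (hs : s ∈ scarfRooms r) (ht : t ∈ scarfDoors r c i₀) (hts : t ⊆ s) :
    ∃ x ∈ s, t = s.erase x :=
  Finset.exists_eq_erase_of_subset hts
    ((mem_scarfDoors.1 ht).1.trans (mem_scarfRooms.1 hs).1.symm)

/-- A room without all colours has an even number of doors. -/
theorem even_card_doors_of_room {r : I → V → L} {c : V → I} {i₀ : I} {s : Finset V}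
    (hs : s ∈ scarfRooms r) (hc : s.image c ≠ Finset.univ) :
    Even {t ∈ scarfDoors r c i₀ | t ⊆ s}.card := by
  have hcard : ∀ x ∈ s, (s.erase x).card + 1 = Fintype.card I := fun x hx => by
    rw [Finset.card_erase_add_one hx, (mem_scarfRooms.1 hs).1]
  by_cases him : s.image c = Finset.univ.erase i₀
  -- One colour occurs twice; the doors arise by deleting either of its two carriers.
  · obtain ⟨x, hx, x', hx', hne, hcx⟩ : ∃ x ∈ s, ∃ x' ∈ s, x ≠ x' ∧ c x = c x' := by
      apply Finset.exists_ne_map_eq_of_card_lt_of_maps_to (t := s.image c)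
      · rw [him, (mem_scarfRooms.1 hs).1]
        exact Finset.card_lt_card (Finset.erase_ssubset (Finset.mem_univ _))
      · exact fun a ha => Finset.mem_image_of_mem c ha
    have key : ∀ a ∈ s, ∀ b ∈ s, a ≠ b → c a = c b → s.erase a ∈ scarfDoors r c i₀ := by
      intro a ha b hb hab hcab
      rw [erase_mem_scarfDoors hs ha, ← him]
      refine (Finset.image_subset_image (Finset.erase_subset _ _)).antisymm ?_
      intro k hk
      obtain ⟨z, hz, rfl⟩ := Finset.mem_image.1 hk
      by_cases hza : z = a
      · exact Finset.mem_image.2 ⟨b, Finset.mem_erase.2 ⟨hab.symm, hb⟩, by rw [hza, hcab]⟩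
      · exact Finset.mem_image_of_mem c (Finset.mem_erase.2 ⟨hza, hz⟩)
    have : {t ∈ scarfDoors r c i₀ | t ⊆ s} = {s.erase x, s.erase x'} := by
      ext t
      simp only [Finset.mem_filter, Finset.mem_insert, Finset.mem_singleton]
      constructor
      · rintro ⟨ht, hts⟩
        obtain ⟨z, hz, rfl⟩ := exists_eq_erase_of_mem_scarfDoors hs ht hts
        by_contra! hcon
        have hzx : x ≠ z := by rintro rfl; exact hcon.1 rfl
        have hzx' : x' ≠ z := by rintro rfl; exact hcon.2 rfl
        have hinj : Set.InjOn c (s.erase z : Finset V) := by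
          rw [← Finset.card_image_iff, (erase_mem_scarfDoors hs hz).1 ht,
            Finset.card_erase_of_mem (Finset.mem_univ _), Finset.card_univ]
          have := hcard z hz
          omega
        exact hne (hinj (by simp [hx, hzx]) (by simp [hx', hzx']) hcx)
      · rintro (rfl | rfl)
        · exact ⟨key x hx x' hx' hne hcx, Finset.erase_subset _ _⟩
        · exact ⟨key x' hx' x hx hne.symm hcx.symm, Finset.erase_subset _ _⟩
    rw [this, Finset.card_pair]
    · exact even_two
    · intro h
      have : x ∈ s.erase x' := Finset.mem_erase.2 ⟨hne, hx⟩
      simp [← h] at this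
  · have : {t ∈ scarfDoors r c i₀ | t ⊆ s} = ∅ := by
      rw [Finset.filter_eq_empty_iff]
      intro t ht hts
      have h1 := (mem_scarfDoors.1 ht).2.2
      have h2 : Finset.univ.erase i₀ ⊆ s.image c := h1 ▸ Finset.image_subset_image hts
      by_cases hi : i₀ ∈ s.image c
      · apply hc
        rw [Finset.eq_univ_iff_forall]
        intro k
        by_cases hk : k = i₀
        · rwa [hk]
        · exact h2 (by simp [hk])
      · exact him (h2.antisymm' (fun k hk => by
          simp only [Finset.mem_erase, Finset.mem_univ, and_true]
          rintro rfl; exact hi hk))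
    simp [this]

/-- An inner door leads to exactly two rooms. -/
theorem card_rooms_of_door {r : I → V → L} (hr : ∀ i, Function.Injective (r i)) {t : Finset V}
    (htc : t.card + 1 = Fintype.card I) (htd : IsDominated r t) (htn : t.Nonempty)
    (hM : ∀ k, ∃ y, ∀ l ≠ k, ∃ x ∈ t, r l x < r l y) :
    {s ∈ scarfRooms r | t ⊆ s}.card = 2 := by
  choose m hmt hm using fun i => Finset.exists_min_image t (r i) htn
  have hm_surj : ∀ x ∈ t, ∃ l, x = m l := fun x hx => by
    obtain ⟨l, hl⟩ := htd x
    exact ⟨l, hr l ((hl _ (hmt l)).antisymm (hm l x hx))⟩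
  -- `m` maps the rankings onto `t`, which has one element fewer, so two rankings share their lowest
  -- point.
  obtain ⟨i, -, j, -, hij, hmij⟩ : ∃ i ∈ Finset.univ, ∃ j ∈ Finset.univ, i ≠ j ∧ m i = m j := by
    apply Finset.exists_ne_map_eq_of_card_lt_of_maps_to (t := t)
    · rw [Finset.card_univ]; omega
    · exact fun a _ => hmt a
  -- `X k` is the only point that can join `t` as the new lowest point of ranking `k`. In a room
  -- distinct rankings have distinct lowest points, so only `k = i` and `k = j` remain.
  have hMk : ∀ k, ∃ x, (∀ l ≠ k, r l (m l) < r l x) ∧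
      ∀ y, (∀ l ≠ k, r l (m l) < r l y) → r k y ≤ r k x := by
    intro k
    classical
    obtain ⟨y, hy⟩ := hM k
    obtain ⟨x, hx, hmax⟩ := Finset.exists_max_image
      {y | ∀ l ≠ k, r l (m l) < r l y} (r k) ⟨y, by
        simp only [Finset.mem_filter, Finset.mem_univ, true_and]
        intro l hl
        obtain ⟨x, hx, hxy⟩ := hy l hl
        exact (hm l x hx).trans_lt hxy⟩
    exact ⟨x, by simpa using hx, fun y hy => hmax y (by simpa using hy)⟩
  choose X hX hXmax using hMk
  have hXle : ∀ k, ∀ x ∈ t, r k (X k) ≤ r k x := by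
    intro k
    obtain ⟨l, hl⟩ := htd (X k)
    by_cases hlk : l = k
    · exact hlk ▸ hl
    · exact absurd (hX k l hlk) (hl _ (hmt l)).not_gt
  have hXdom : ∀ k, IsDominated r (insert (X k) t) := by
    intro k y
    by_cases hy : ∀ l ≠ k, r l (m l) < r l y
    · refine ⟨k, fun x hx => ?_⟩
      have := hXmax k y hy
      rcases Finset.mem_insert.1 hx with rfl | hx
      · exact this
      · exact this.trans (hXle k x hx)
    · push Not at hy
      obtain ⟨l, hl, hly⟩ := hy
      refine ⟨l, fun x hx => ?_⟩
      rcases Finset.mem_insert.1 hx with rfl | hx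
      · exact hly.trans (hX k l hl).le
      · exact hly.trans (hm l x hx)
  have hXnot : ∀ k k', k ≠ k' → m k = m k' → X k ∉ t := by
    intro k k' hkk' hmk hXt
    obtain ⟨l, hl⟩ := hm_surj _ hXt
    by_cases hlk : l = k
    · have := hX k k' hkk'.symm
      rw [hl, hlk, hmk] at this
      exact this.false
    · have := hX k l hlk
      rw [← hl] at this
      exact this.false
  have hi := hXnot i j hij hmij
  have hj := hXnot j i hij.symm hmij.symm
  have hXne : X i ≠ X j := by
    intro h
    have h1 := hX i j hij.symm
    rw [h] at h1
    exact absurd h1 (hXle j _ (hmt j)).not_gt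
  have : {s ∈ scarfRooms r | t ⊆ s} = {insert (X i) t, insert (X j) t} := by
    ext s
    simp only [Finset.mem_filter, Finset.mem_insert, Finset.mem_singleton, mem_scarfRooms]
    constructor
    · rintro ⟨⟨hsc, hsd⟩, hts⟩
      obtain ⟨x, hxt, rfl⟩ := Finset.exists_eq_insert_iff.2 ⟨hts, htc.trans hsc.symm⟩
      choose m' hm's hm' using fun i =>
        Finset.exists_min_image (insert x t) (r i) (Finset.insert_nonempty _ _)
      have hm'_surj : ∀ z ∈ insert x t, ∃ l, m' l = z := fun z hz => by
        obtain ⟨l, hl⟩ := hsd z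
        exact ⟨l, hr l ((hm' l z hz).antisymm (hl _ (hm's l)))⟩
      have hm'_inj : Function.Injective m' := by
        have himage : Finset.univ.image m' = insert x t := by
          ext z
          constructor
          · intro hz
            obtain ⟨l, -, rfl⟩ := Finset.mem_image.1 hz
            exact hm's l
          · intro hz
            obtain ⟨l, rfl⟩ := hm'_surj z hz
            simp
        have := Finset.card_image_iff.1
          (show (Finset.univ.image m').card = (Finset.univ : Finset I).card by
            rw [himage, hsc, Finset.card_univ])
        simpa using this
      obtain ⟨k, hk⟩ := hm'_surj x (Finset.mem_insert_self _ _)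
      have hmm' : ∀ l ≠ k, m' l = m l := by
        intro l hl
        have hne : m' l ≠ x := fun h => hl (hm'_inj (h.trans hk.symm))
        have hmem : m' l ∈ t := (Finset.mem_insert.1 (hm's l)).resolve_left hne
        exact hr l ((hm' l _ (Finset.mem_insert_of_mem (hmt l))).antisymm (hm l _ hmem))
      have hkij : k = i ∨ k = j := by
        by_contra! hcon
        exact hij (hm'_inj ((hmm' i hcon.1.symm).trans (hmij.trans (hmm' j hcon.2.symm).symm)))
      have hxk : x = X k := by
        apply hr k
        apply le_antisymm
        · refine hXmax k x fun l hl => lt_of_le_of_ne ?_ fun h => ?_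
          · rw [← hmm' l hl]
            exact hm' l x (Finset.mem_insert_self _ _)
          · exact hxt (hr l h ▸ hmt l)
        · obtain ⟨l, hl⟩ := hsd (X k)
          by_cases hlk : l = k
          · exact hlk ▸ hl x (Finset.mem_insert_self _ _)
          · exact absurd (hX k l hlk) (hl _ (Finset.mem_insert_of_mem (hmt l))).not_gt
      rcases hkij with rfl | rfl
      · exact Or.inl (by rw [hxk])
      · exact Or.inr (by rw [hxk])
    · rintro (rfl | rfl)
      · exact ⟨⟨by rw [Finset.card_insert_of_notMem hi, htc], hXdom i⟩, Finset.subset_insert _ _⟩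
      · exact ⟨⟨by rw [Finset.card_insert_of_notMem hj, htc], hXdom j⟩, Finset.subset_insert _ _⟩
  rw [this, Finset.card_pair]
  intro h
  have : X i ∈ insert (X j) t := h ▸ Finset.mem_insert_self _ _
  exact (Finset.mem_insert.1 this).elim hXne hi

/-- **Scarf's lemma**: with slack points `b i`, each lowest in its own ranking and above all
non-slack points in the others, some dominated set carries all colours. -/
theorem exists_isDominated_rainbow [Nonempty I] {r : I → V → L}
    (hr : ∀ i, Function.Injective (r i)) {b : I → V} {c : V → I} (hcb : ∀ i, c (b i) = i)
    (hlow : ∀ i v, r i (b i) ≤ r i v)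
    (hhigh : ∀ i k v, i ≠ k → v ∉ Set.range b → r k v < r k (b i)) :
    ∃ s, IsDominated r s ∧ s.image c = Finset.univ := by
  classical
  obtain ⟨i₀⟩ := ‹Nonempty I›
  by_contra! hcon
  have hb : Function.Injective b := fun i j h => by rw [← hcb i, h, hcb]
  -- The outer door: the only door lying in exactly one room, which makes the total count odd.
  set o : Finset V := (Finset.univ.erase i₀).image b with ho
  have hocard : o.card + 1 = Fintype.card I := by
    rw [ho, Finset.card_image_of_injective _ hb, Finset.card_erase_add_one (Finset.mem_univ _),
      Finset.card_univ]
  have hoy : ∀ y ∉ o, ∀ x ∈ o, r i₀ y ≤ r i₀ x := by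
    intro y hy x hx
    obtain ⟨p, hp, rfl⟩ := Finset.mem_image.1 hx
    by_cases hyb : y ∈ Set.range b
    · obtain ⟨q, rfl⟩ := hyb
      have hq : q = i₀ := by
        by_contra hq
        exact hy (Finset.mem_image_of_mem b (by simp [hq]))
      exact hq ▸ hlow q _
    · exact (hhigh p i₀ y (Finset.ne_of_mem_erase hp) hyb).le
  have hob : b i₀ ∉ o := by
    simp [ho, hb.eq_iff]
  obtain ⟨x₀, hx₀, hx₀max⟩ := Finset.exists_max_image oᶜ (r i₀) ⟨b i₀, by simpa using hob⟩
  rw [Finset.mem_compl] at hx₀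
  have hodom : IsDominated r (insert x₀ o) := by
    intro y
    by_cases hy : y ∈ o
    · obtain ⟨p, hp, rfl⟩ := Finset.mem_image.1 hy
      exact ⟨p, fun x _ => hlow p x⟩
    · refine ⟨i₀, fun x hx => ?_⟩
      rcases Finset.mem_insert.1 hx with rfl | hx
      · exact hx₀max y (by simpa using hy)
      · exact hoy y hy x hx
  have homem : o ∈ scarfDoors r c i₀ := by
    refine mem_scarfDoors.2 ⟨hocard, hodom.mono (Finset.subset_insert _ _), ?_⟩
    rw [ho, Finset.image_image]
    simp [Function.comp_def, hcb]
  have hocount : {s ∈ scarfRooms r | o ⊆ s}.card = 1 := by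
    rw [Finset.card_eq_one]
    refine ⟨insert x₀ o, ?_⟩
    ext s
    simp only [Finset.mem_filter, Finset.mem_singleton, mem_scarfRooms]
    constructor
    · rintro ⟨⟨hsc, hsd⟩, hos⟩
      obtain ⟨x, hxo, rfl⟩ := Finset.exists_eq_insert_iff.2 ⟨hos, hocard.trans hsc.symm⟩
      have : x₀ = x := by
        obtain ⟨l, hl⟩ := hsd x₀
        have hl0 : l = i₀ := by
          by_contra hl0
          have hbl : b l ∈ o := Finset.mem_image_of_mem b (by simp [hl0])
          have := hl (b l) (Finset.mem_insert_of_mem hbl)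
          exact hx₀ (hr l (this.antisymm (hlow l x₀)) ▸ hbl)
        subst hl0
        exact hr l ((hl x (Finset.mem_insert_self _ _)).antisymm (hx₀max x (by simpa using hxo)))
      rw [this]
    · rintro rfl
      exact ⟨⟨by rw [Finset.card_insert_of_notMem hx₀, hocard], hodom⟩, Finset.subset_insert _ _⟩
  have hinner : ∀ t ∈ scarfDoors r c i₀, t ≠ o → {s ∈ scarfRooms r | t ⊆ s}.card = 2 := by
    intro t ht hto
    obtain ⟨htc, htd, htcol⟩ := mem_scarfDoors.1 ht
    have htn : t.Nonempty := by
      rw [Finset.nonempty_iff_ne_empty]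
      rintro rfl
      apply hto
      symm
      rw [← Finset.card_eq_zero]
      simp only [Finset.card_empty] at htc
      omega
    refine card_rooms_of_door hr htc htd htn fun k => ⟨b k, fun l hlk => ?_⟩
    -- If `b k` fails in ranking `l`, then `t` has only slack points and omits `b l`; its colours
    -- force `l = i₀`, so `t = o`.
    by_contra! hle
    apply hto
    have hsub : t ⊆ (Finset.univ.erase l).image b := by
      intro x hx
      by_cases hxb : x ∈ Set.range b
      · obtain ⟨p, rfl⟩ := hxb
        refine Finset.mem_image_of_mem b ?_
        simp only [Finset.mem_erase, Finset.mem_univ, and_true]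
        rintro rfl
        exact hlk (hb (hr p ((hlow p _).antisymm (hle _ hx))))
      · exact absurd (hhigh k l x hlk.symm hxb) (hle x hx).not_gt
    have hteq : t = (Finset.univ.erase l).image b := by
      refine Finset.eq_of_subset_of_card_le hsub ?_
      rw [Finset.card_image_of_injective _ hb, Finset.card_erase_of_mem (Finset.mem_univ _),
        Finset.card_univ]
      omega
    rw [hteq, Finset.image_image] at htcol
    have hl : l = i₀ := by
      by_contra hl
      have : l ∈ Finset.univ.erase i₀ := by simp [hl]
      rw [← htcol] at this
      simp [hcb] at this
    rw [hteq, hl]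
  have hcount := Finset.sum_card_bipartiteAbove_eq_sum_card_bipartiteBelow
    (s := scarfDoors r c i₀) (t := scarfRooms r) (fun t s => t ⊆ s)
  simp only [Finset.bipartiteAbove, Finset.bipartiteBelow] at hcount
  have heven : Even (∑ s ∈ scarfRooms r, {t ∈ scarfDoors r c i₀ | t ⊆ s}.card) :=
    Finset.even_sum _ fun s hs => even_card_doors_of_room hs (hcon s (mem_scarfRooms.1 hs).2)
  rw [← hcount, ← Finset.add_sum_erase _ _ homem, hocount, Finset.sum_congr rfl fun t ht =>
    hinner t (Finset.mem_of_mem_erase ht) (Finset.ne_of_mem_erase ht)] at heven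
  simp [parity_simps] at heven

end Scarf

/-! ### From Scarf's lemma to the KKM lemma -/

section KKM

variable {I : Type*} [Fintype I]

theorem exists_le_sum_eq [Nonempty I] (u : I → ℕ) {N : ℕ} (hu : ∑ k, u k ≤ N) :
    ∃ y : I → ℕ, u ≤ y ∧ ∑ k, y k = N := by
  classical
  obtain ⟨k₀⟩ := ‹Nonempty I›
  refine ⟨u + Pi.single k₀ (N - ∑ k, u k), le_self_add, ?_⟩
  simp only [Pi.add_apply, Finset.sum_add_distrib, Finset.sum_pi_single', Finset.mem_univ, if_true]
  omega

/-- For a colouring of the integer points of the dilated simplex by its vertices, some point is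
close to a point of colour `k` or to the face opposite to the vertex `k`, for every `k`. -/
theorem exists_close_to_every_colour [Nonempty I] (N : ℕ) (col : (I → ℕ) → I) :
    ∃ a : I → ℕ, ∑ k, a k = N ∧ ∀ k, a k ≤ Fintype.card I ∨
      ∃ a' : I → ℕ, ∑ l, a' l = N ∧ col a' = k ∧ ∀ l, |(a' l : ℤ) - a l| ≤ Fintype.card I := by
  classical
  let T := Finset.piAntidiag (Finset.univ : Finset I) N
  have hT : ∀ a : I → ℕ, a ∈ T ↔ ∑ k, a k = N := by simp [T]
  let V := T ⊕ I
  let h : I → V → ℤ := fun k => Sum.elim (fun a => (a.1 k : ℤ)) fun i => if i = k then -1 else N + 1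
  -- Rank by the `k`-th coordinate; an enumeration of `V` breaks ties.
  let r : I → V → Lex (ℤ × Fin (Fintype.card V)) := fun k v => toLex (h k v, Fintype.equivFin V v)
  have hrh : ∀ k v w, r k v ≤ r k w → h k v ≤ h k w := fun k v w hvw =>
    Prod.Lex.monotone_fst _ _ hvw
  have hlt : ∀ k v w, h k v < h k w → r k v < r k w := fun k v w hvw =>
    Prod.Lex.toLex_lt_toLex.2 (Or.inl hvw)
  have hbot : ∀ k v, -1 ≤ h k v := by
    rintro k (a | i)
    · simp only [h, Sum.elim_inl]; omega
    · simp only [h, Sum.elim_inr]; split_ifs <;> omega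
  obtain ⟨s, hsd, hsc⟩ := exists_isDominated_rainbow (r := r) (b := Sum.inr)
    (c := Sum.elim (fun a => col a.1) id)
    (fun k v w hvw => (Fintype.equivFin V).injective (congrArg (fun p => (ofLex p).2) hvw))
    (fun i => rfl)
    (by
      rintro i (a | k)
      · refine (hlt _ _ _ ?_).le
        simp only [h, Sum.elim_inl, Sum.elim_inr, if_true]; omega
      · by_cases hki : k = i
        · rw [hki]
        · refine (hlt _ _ _ ?_).le
          simp only [h, Sum.elim_inr, if_true, if_neg hki]; omega)
    (by
      rintro i k (a | j) hik hv
      · refine hlt _ _ _ ?_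
        have : a.1 k ≤ N := by
          rw [← (hT _).1 a.2]
          exact Finset.single_le_sum (fun _ _ => Nat.zero_le _) (Finset.mem_univ k)
        simp only [h, Sum.elim_inl, Sum.elim_inr, if_neg hik]; omega
      · exact absurd ⟨j, rfl⟩ hv)
  have hcol : ∀ k, ∃ v ∈ s, Sum.elim (fun a : T => col a.1) id v = k := fun k =>
    Finset.mem_image.1 (hsc ▸ Finset.mem_univ k)
  have hsn : s.Nonempty := by
    obtain ⟨v, hv, -⟩ := hcol (Classical.arbitrary I)
    exact ⟨v, hv⟩
  choose v hvs hv using fun k => Finset.exists_min_image s (h k) hsn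
  -- Otherwise some grid point has every coordinate above the minimum over `s`, contradicting
  -- domination. Hence the grid points of `s` are close together.
  have hsum : (N : ℤ) < ∑ k, (h k (v k) + 1) := by
    by_contra! hle
    have hnn : ∀ k, ((h k (v k) + 1).toNat : ℤ) = h k (v k) + 1 := fun k =>
      Int.toNat_of_nonneg (by linarith [hbot k (v k)])
    obtain ⟨y, huy, hyN⟩ := exists_le_sum_eq (fun k => (h k (v k) + 1).toNat) (N := N) (by
      zify
      simpa only [hnn] using hle)
    obtain ⟨k, hk⟩ := hsd (Sum.inl ⟨y, (hT y).2 hyN⟩)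
    have h1 := hrh _ _ _ (hk _ (hvs k))
    have h2 : ((h k (v k) + 1).toNat : ℤ) ≤ y k := by exact_mod_cast huy k
    rw [hnn] at h2
    simp only [h, Sum.elim_inl] at h1 h2
    omega
  have hlow : ∀ a : T, Sum.inl a ∈ s → ∀ k, h k (v k) ≤ a.1 k := fun a ha k => hv k _ ha
  have hup : ∀ a : T, Sum.inl a ∈ s → ∀ k, (a.1 k : ℤ) < h k (v k) + Fintype.card I := by
    intro a ha k
    have haN : ∑ l, (a.1 l : ℤ) = N := by exact_mod_cast (hT _).1 a.2
    have h1 : ∑ l, ((a.1 l : ℤ) - h l (v l)) < Fintype.card I := by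
      rw [Finset.sum_add_distrib] at hsum
      rw [Finset.sum_sub_distrib, haN]
      simp only [Finset.sum_const, Finset.card_univ, nsmul_eq_mul, mul_one] at hsum
      linarith
    have h2 := Finset.single_le_sum (f := fun l => (a.1 l : ℤ) - h l (v l))
      (fun l _ => sub_nonneg.2 (hlow a ha l)) (Finset.mem_univ k)
    linarith
  have hslack : ∀ k, Sum.inr k ∈ s → h k (v k) = -1 := by
    intro k hk
    refine le_antisymm ?_ (hbot _ _)
    simpa [h] using hv k _ hk
  obtain ⟨a, ha⟩ : ∃ a : T, Sum.inl a ∈ s := by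
    by_contra! hno
    have : ∀ k, h k (v k) = -1 := by
      intro k
      apply hslack
      obtain ⟨w | i, hws, hwk⟩ := hcol k
      · exact absurd hws (hno w)
      · have : i = k := hwk
        rwa [← this]
    simp only [this, neg_add_cancel, Finset.sum_const_zero] at hsum
    omega
  refine ⟨a.1, (hT _).1 a.2, fun k => ?_⟩
  obtain ⟨w | i, hws, hwk⟩ := hcol k
  · refine Or.inr ⟨w.1, (hT _).1 w.2, hwk, fun l => ?_⟩
    have := hlow a ha l
    have := hlow w hws l
    have := hup a ha l
    have := hup w hws l
    rw [abs_le]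
    constructor <;> linarith
  · left
    have hi : i = k := hwk
    subst hi
    have := hup a ha i
    rw [hslack i hws] at this
    omega

/-- Colour each grid point by a set containing it and refine the grid. Minimizing the sum `S` of
distances to the sets `H k` replaces extracting a convergent subsequence. -/
theorem exists_mem_stdSimplex_forall_eq_zero_or_mem [Nonempty I] {G : I → Set (I → ℝ)}
    (hG : ∀ k, IsClosed (G k)) (hcover : stdSimplex ℝ I ⊆ ⋃ k, G k) :
    ∃ z ∈ stdSimplex ℝ I, ∀ k, z k = 0 ∨ z ∈ G k := by
  classical
  let H : I → Set (I → ℝ) := fun k => G k ∪ {x | x k ≤ 0}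
  have hH : ∀ k, IsClosed (H k) := fun k =>
    (hG k).union (isClosed_le (continuous_apply k) continuous_const)
  have hHne : ∀ k, (H k).Nonempty := fun k => ⟨0, Or.inr (by simp)⟩
  let S : (I → ℝ) → ℝ := fun x => ∑ k, Metric.infDist x (H k)
  have hS : Continuous S := continuous_finsetSum _ fun k _ => Metric.continuous_infDist_pt _
  have hΔ : (stdSimplex ℝ I).Nonempty := ⟨_, single_mem_stdSimplex ℝ (Classical.arbitrary I)⟩
  obtain ⟨z, hz, hzmin⟩ := (isCompact_stdSimplex ℝ I).exists_isMinOn hΔ hS.continuousOn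
  set n : ℝ := (Fintype.card I : ℝ) with hn
  have hbound : ∀ N : ℕ, 0 < N → S z ≤ n * (n / N) := by
    intro N hN
    have hN' : (0 : ℝ) < N := by exact_mod_cast hN
    let p : (I → ℕ) → I → ℝ := fun a k => a k / N
    have hp : ∀ a : I → ℕ, ∑ k, a k = N → p a ∈ stdSimplex ℝ I := by
      intro a ha
      refine ⟨fun k => by positivity, ?_⟩
      have : ∑ k, (a k : ℝ) = N := by exact_mod_cast ha
      simp only [p, ← Finset.sum_div, this]
      exact div_self hN'.ne'
    have hex : ∀ a : I → ℕ, ∃ k, ∑ l, a l = N → p a ∈ G k := by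
      intro a
      by_cases ha : ∑ l, a l = N
      · obtain ⟨k, hk⟩ := Set.mem_iUnion.1 (hcover (hp a ha))
        exact ⟨k, fun _ => hk⟩
      · exact ⟨Classical.arbitrary I, fun h => absurd h ha⟩
    choose col hcol using hex
    obtain ⟨a, ha, hak⟩ := exists_close_to_every_colour N col
    refine (hzmin (hp a ha)).trans ?_
    have : ∀ k ∈ Finset.univ, Metric.infDist (p a) (H k) ≤ n / N := by
      intro k _
      rcases hak k with hk | ⟨a', ha', rfl, hclose⟩
      · refine (Metric.infDist_le_dist_of_mem (y := Function.update (p a) k 0)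
          (Or.inr (by simp))).trans ?_
        rw [dist_pi_le_iff (by positivity)]
        intro l
        by_cases hl : l = k
        · subst hl
          simp only [Function.update_self, Real.dist_eq, sub_zero, p]
          rw [abs_of_nonneg (by positivity)]
          gcongr
          exact Nat.cast_le.2 hk
        · rw [Function.update_of_ne hl, dist_self]
          positivity
      · refine (Metric.infDist_le_dist_of_mem (y := p a') (Or.inl (hcol a' ha'))).trans ?_
        rw [dist_pi_le_iff (by positivity)]
        intro l
        have : |(a' l : ℝ) - a l| ≤ n := by
          rw [hn]
          exact_mod_cast hclose l
        simp only [Real.dist_eq, p]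
        rw [abs_sub_comm, ← sub_div, abs_div, abs_of_pos hN']
        gcongr
    refine (Finset.sum_le_sum this).trans ?_
    simp [hn]
  have hSz : S z ≤ 0 := by
    by_contra! hpos
    obtain ⟨N, hN⟩ := exists_nat_gt (n * n / S z)
    have hN' : (0 : ℝ) < N := lt_of_le_of_lt (by positivity) hN
    have h1 := hbound N (by exact_mod_cast hN')
    rw [div_lt_iff₀ hpos] at hN
    rw [← mul_div_assoc, le_div_iff₀ hN'] at h1
    linarith
  refine ⟨z, hz, fun k => ?_⟩
  have h0 : Metric.infDist z (H k) = 0 := by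
    refine le_antisymm (le_trans ?_ hSz) Metric.infDist_nonneg
    exact Finset.single_le_sum (f := fun k => Metric.infDist z (H k))
      (fun _ _ => Metric.infDist_nonneg) (Finset.mem_univ k)
  rcases ((hH k).mem_iff_infDist_zero (hHne k)).2 h0 with h | h
  · exact Or.inr h
  · exact Or.inl (le_antisymm h (hz.1 k))

/-- **Knaster–Kuratowski–Mazurkiewicz lemma**: closed sets `F k` that cover each face of the
standard simplex by the sets of its own vertices have a common point. -/
theorem exists_mem_stdSimplex_iInter [Nonempty I] {F : I → Set (I → ℝ)}
    (hF : ∀ k, IsClosed (F k)) (hcover : ∀ z ∈ stdSimplex ℝ I, ∃ k, z k ≠ 0 ∧ z ∈ F k) :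
    ∃ z ∈ stdSimplex ℝ I, ∀ k, z ∈ F k := by
  classical
  have hFne : ∀ k, (F k).Nonempty := by
    intro k
    obtain ⟨l, hl, hlF⟩ := hcover _ (single_mem_stdSimplex ℝ k)
    exact ⟨_, by
      have : l = k := by
        by_contra hlk
        exact hl (by simp [hlk])
      exact this ▸ hlF⟩
  let g : I → (I → ℝ) → ℝ := fun k x => Metric.infDist x (F k)
  have hg : ∀ k, Continuous (g k) := fun k => Metric.continuous_infDist_pt _
  have hg0 : ∀ k x, 0 ≤ g k x := fun k x => Metric.infDist_nonneg
  let S : (I → ℝ) → ℝ := fun x => ∑ k, g k x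
  have hS : Continuous S := continuous_finsetSum _ fun k _ => hg k
  -- The weights `x k` sum to 1, so strict failure for every `k` would give `S x < S x`; thus these
  -- sets cover. At `z` the same sum forces equality for each `k`.
  obtain ⟨z, hz, hzG⟩ := exists_mem_stdSimplex_forall_eq_zero_or_mem
    (G := fun k => {x | x k * S x ≤ g k x})
    (fun k => isClosed_le ((continuous_apply k).mul hS) (hg k)) (by
      intro x hx
      by_contra hno
      simp only [Set.mem_iUnion, Set.mem_ofPred_eq, not_exists, not_le] at hno
      have : S x < ∑ k, x k * S x :=
        Finset.sum_lt_sum_of_nonempty Finset.univ_nonempty fun k _ => hno k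
      rw [← Finset.sum_mul, hx.2, one_mul] at this
      exact this.false)
  have hle : ∀ k, z k * S z ≤ g k z := by
    intro k
    rcases hzG k with h | h
    · rw [h, zero_mul]; exact hg0 k z
    · exact h
  have heq : ∀ k, z k * S z = g k z := by
    have := (Finset.sum_eq_sum_iff_of_le fun k _ => hle k).1
      (show ∑ k, z k * S z = ∑ k, g k z by rw [← Finset.sum_mul, hz.2, one_mul])
    exact fun k => this k (Finset.mem_univ k)
  obtain ⟨j, hj, hjF⟩ := hcover z hz
  have hS0 : S z = 0 := by
    have : z j * S z = 0 := by rw [heq j]; exact Metric.infDist_zero_of_mem hjF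
    exact (mul_eq_zero.1 this).resolve_left hj
  refine ⟨z, hz, fun k => ((hF k).mem_iff_infDist_zero (hFne k)).2 ?_⟩
  have := heq k
  rw [hS0, mul_zero] at this
  exact this.symm

end KKM

/-! ### Ky Fan's inequality for finitely many points -/

section KyFan

open Set

variable {E : Type*} [NormedAddCommGroup E] [NormedSpace ℝ E]

/-- In a reflexive space, bounded weakly closed sets are weakly compact. -/
theorem IsWeaklyClosed.isCompact_of_isBounded (hE : IsReflexiveSpace E) {s : Set E}
    (hs : IsWeaklyClosed s) (hb : Bornology.IsBounded s) : IsCompact (toWeakSpace ℝ E '' s) := by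
  rw [← IsClosed.closure_eq hs]
  refine NormedSpace.isCompact_closure_of_isBounded ℝ E _ ?_ ?_
  · rwa [preimage_image_eq _ (toWeakSpace ℝ E).injective]
  · intro φ _
    obtain ⟨x, hx⟩ := hE (WeakDual.toStrongDual φ)
    refine ⟨toWeakSpace ℝ E x, ?_⟩
    exact DFunLike.ext _ _ fun ψ => congrArg (fun T => T ψ) hx

/-- The finite form of Ky Fan's inequality. -/
theorem exists_forall_mem_finset_le {X : Set E} (hXc : Convex ℝ X) {f : E → E → ℝ}
    (hqc : ∀ y ∈ X, QuasiconcaveOn ℝ X (fun x => f x y))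
    (hlsc : ∀ x ∈ X, WeaklyLowerSemicontinuousOn X (fun y => f x y))
    {M : ℝ} (hM : ∀ x ∈ X, f x x ≤ M) {s : Finset E} (hs : s.Nonempty) (hsX : ∀ x ∈ s, x ∈ X) :
    ∃ y ∈ X, ∀ x ∈ s, f x y ≤ M := by
  classical
  have : Nonempty s := hs.to_subtype
  let L : (s → ℝ) → E := fun z => ∑ k, z k • (k : E)
  have hL : Continuous fun z => toWeakSpace ℝ E (L z) :=
    (toWeakSpaceCLM ℝ E).continuous.comp (by fun_prop)
  have hLX : ∀ z ∈ stdSimplex ℝ s, L z ∈ X := fun z hz =>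
    hXc.sum_mem (fun k _ => hz.1 k) hz.2 fun k _ => hsX k k.2
  obtain ⟨z, hz, hzF⟩ := exists_mem_stdSimplex_iInter
    (F := fun k : s => {z | toWeakSpace ℝ E (L z) ∈ toWeakSpace ℝ E '' {y ∈ X | f k y ≤ M}})
    (fun k => IsClosed.preimage hL (hlsc k (hsX k k.2) M)) (by
      intro z hz
      by_contra! hno
      have hlt : ∀ k, z k ≠ 0 → M < f k (L z) := fun k hk =>
        not_le.1 fun hle => hno k hk ⟨L z, ⟨hLX z hz, hle⟩, rfl⟩
      have hsum : ∑ k ∈ Finset.univ.filter (fun k => z k ≠ 0), z k = 1 := by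
        rw [Finset.sum_filter_ne_zero, hz.2]
      have hLz : ∑ k ∈ Finset.univ.filter (fun k => z k ≠ 0), z k • (k : E) = L z :=
        Finset.sum_filter_of_ne fun k _ hk hk0 => hk (by rw [hk0, zero_smul])
      -- All supporting vertices lie in the superlevel set at the smallest value `f k₀ (L z) > M`,
      -- hence so does `L z`, against the diagonal bound.
      obtain ⟨k₀, hk₀, hmin⟩ := Finset.exists_min_image
        (Finset.univ.filter fun k => z k ≠ 0) (fun k => f k (L z))
        (Finset.nonempty_of_sum_ne_zero (f := z) (by rw [hsum]; exact one_ne_zero))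
      have hmem := (hqc (L z) (hLX z hz) (f k₀ (L z))).sum_mem (fun k _ => hz.1 k) hsum
        fun k hk => ⟨hsX k k.2, hmin k hk⟩
      rw [hLz] at hmem
      have h1 := hlt k₀ (Finset.mem_filter.1 hk₀).2
      exact absurd (hM _ hmem.1) (h1.trans_le hmem.2).not_ge)
  refine ⟨L z, hLX z hz, fun x hx => ?_⟩
  obtain ⟨y, hy, hyz⟩ := hzF ⟨x, hx⟩
  rw [← (toWeakSpace ℝ E).injective hyz]
  exact hy.2

end KyFan

/-! ### Weak compactness and attainment of the minimum -/

theorem mainTheorem1 {E : Type*} [NormedAddCommGroup E] [NormedSpace ℝ E] [CompleteSpace E]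
    (hE : IsReflexiveSpace E) (X : Set E) (hX : X.Nonempty) (hXc : Convex ℝ X)
    (f : E → E → ℝ)
    (h_quasiconcave : ∀ y ∈ X, QuasiconcaveOn ℝ X (fun x => f x y))
    (h_wlsc : ∀ x ∈ X, WeaklyLowerSemicontinuousOn X (fun y => f x y))
    (m : EReal) (hm : m = ⨆ x ∈ X, (f x x : EReal)) (hm_lt : m < ⊤)
    (h_bdd : ∃ x₀ ∈ X, Bornology.IsBounded {y ∈ X | (f x₀ y : EReal) ≤ m}) :
    ∃ y₀ ∈ X, IsMinOn (fun y => ⨆ x ∈ X, (f x y : EReal)) X y₀ ∧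
      (⨆ x ∈ X, (f x y₀ : EReal)) ≤ ⨆ x ∈ X, (f x x : EReal) := by
  classical
  obtain ⟨x₀, hx₀, hbdd⟩ := h_bdd
  have hdiag : ∀ x ∈ X, (f x x : EReal) ≤ m := fun x hx =>
    hm ▸ le_iSup₂ (f := fun x (_ : x ∈ X) => (f x x : EReal)) x hx
  have hm_bot : m ≠ ⊥ := ((EReal.bot_lt_coe _).trans_le (hdiag x₀ hx₀)).ne'
  lift m to ℝ using ⟨hm_lt.ne, hm_bot⟩
  simp only [EReal.coe_le_coe_iff] at hdiag hbdd
  rw [← hm]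
  let A : X → Set (WeakSpace ℝ E) := fun x => toWeakSpace ℝ E '' {y ∈ X | f x y ≤ m}
  have hAclosed : ∀ x, IsClosed (A x) := fun x => h_wlsc x x.2 m
  have hA₀ : IsCompact (A ⟨x₀, hx₀⟩) :=
    IsWeaklyClosed.isCompact_of_isBounded hE (h_wlsc x₀ hx₀ m) hbdd
  -- `K` corresponds to the points of `X` where the supremum is at most `m`.
  let K := A ⟨x₀, hx₀⟩ ∩ ⋂ x, A x
  have hK : IsCompact K := hA₀.inter_right (isClosed_iInter hAclosed)
  have hKne : K.Nonempty := by
    refine hA₀.inter_iInter_nonempty A hAclosed fun u => ?_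
    obtain ⟨y, hyX, hy⟩ := exists_forall_mem_finset_le hXc h_quasiconcave h_wlsc hdiag
      (s := insert x₀ (u.image Subtype.val)) (Finset.insert_nonempty _ _) (by
        intro x hx
        rcases Finset.mem_insert.1 hx with rfl | hx
        · exact hx₀
        · obtain ⟨x, -, rfl⟩ := Finset.mem_image.1 hx
          exact x.2)
    refine ⟨toWeakSpace ℝ E y, ⟨y, ⟨hyX, hy _ (Finset.mem_insert_self _ _)⟩, rfl⟩,
      Set.mem_iInter₂.2 fun x hx => ⟨y, ⟨hyX, hy _ ?_⟩, rfl⟩⟩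
    exact Finset.mem_insert_of_mem (Finset.mem_image_of_mem _ hx)
  let g : E → EReal := fun y => ⨆ x ∈ X, (f x y : EReal)
  have hmemK : ∀ y ∈ X, g y ≤ m → toWeakSpace ℝ E y ∈ K := by
    intro y hy hgy
    have hle : ∀ x ∈ X, f x y ≤ m := fun x hx => EReal.coe_le_coe_iff.1 ((le_iSup₂ (f := fun x
      (_ : x ∈ X) => (f x y : EReal)) x hx).trans hgy)
    exact ⟨⟨y, ⟨hy, hle x₀ hx₀⟩, rfl⟩, Set.mem_iInter.2 fun x => ⟨y, ⟨hy, hle x x.2⟩, rfl⟩⟩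
  have hlsc : LowerSemicontinuousOn (fun w => g ((toWeakSpace ℝ E).symm w)) K := by
    refine lowerSemicontinuousOn_biSup fun x hx => ?_
    refine continuous_coe_real_ereal.comp_lowerSemicontinuousOn (g := ((↑) : ℝ → EReal))
      (f := fun w => f x ((toWeakSpace ℝ E).symm w)) ?_ EReal.coe_strictMono.monotone
    rw [lowerSemicontinuousOn_iff_preimage_Iic]
    intro l
    refine ⟨_, h_wlsc x hx l, ?_⟩
    ext w
    refine and_congr_right fun hw => ?_
    obtain ⟨y, hy, rfl⟩ := hw.1
    simp [hy.1]
  obtain ⟨w, hwK, hmin⟩ := hlsc.exists_isMinOn hKne hK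
  obtain ⟨y, hy, rfl⟩ := hwK.1
  have hgm : g y ≤ m := by
    refine iSup₂_le fun x hx => ?_
    obtain ⟨y', hy', hyy'⟩ := Set.mem_iInter.1 hwK.2 ⟨x, hx⟩
    rw [← (toWeakSpace ℝ E).injective hyy']
    exact EReal.coe_le_coe_iff.2 hy'.2
  refine ⟨y, hy.1, fun y' hy' => ?_, hgm⟩
  by_cases hle : g y' ≤ m
  · simpa [g] using hmin (hmemK y' hy' hle)
  · exact hgm.trans (not_le.1 hle).le
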